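/- Let $\mathcal I$ be a countable commutative semiring whose addition is cancellative (a multiplicative unit is not needed), and let $p:(\mathcal I,+)\to\mathbb Z_2$ be a monoid homomorphism (a parity function). Let $K(\mathcal I)$ be the Grothendieck group of $(\mathcal I,+)$; for $\alpha=[(j,k)]\in K(\mathcal I)$ and $i\in\mathcal I$ put $p(\alpha i)=p(ji)+p(ki)$. All algebras are real. Gradings are understood in the completed sense: an $\mathcal I$-graded algebra is a unital associative algebra $A$ with subspaces $A_i$ and projections $A\to A_i$ that identify $A$ with $\prod_{i\in\mathcal I}A_i$, such that $1\in A_0$ and $A_iA_j\subset A_{i+j}$. An $\mathcal I$-graded ringed space is a topological space with a sheaf of algebras whose algebras of sections are $\mathcal I$-graded, the restrictions being compatible with the projections to homogeneous components. Let $V$ be a finite-dimensional $\mathcal I$-graded real vector space with $V_0=0$ and $\dim V_i=m_i$, and let $S(V)=\bigoplus_n S^n(V)$ be its symmetric algebra, the quotient of the tensor algebra by the relations $v\otimes w=(-1)^{p(d(v)d(w))}w\otimes v$ for homogeneous $v,w$ of degrees $d(v),d(w)$. Let $\overline{S(V)}=\prod_n S^n(V)$. An $\mathcal I$-graded manifold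 $\mathcal M=(M,\mathcal O)$ of dimension $n|(m_i)$ is an $\mathcal I$-graded ringed space, with $M$ Hausdorff and second countable, such that every point of $M$ has an open neighbourhood $U$ for which there are a homeomorphism of $U$ onto an open subset $W$ of $\mathbb R^n$ and, over it, an isomorphism of $\mathcal O|_U$ with the sheaf of $\overline{S(V)}$-valued smooth functions on $W$, as sheaves of $\mathcal I$-graded algebras. (So $M$ is an $n$-dimensional manifold.) For $U\subset M$ open and $\alpha\in K(\mathcal I)$ let $\mathfrak X(U)_\alpha$ be the space of derivations of degree $\alpha$ of $\mathcal O(U)$, i.e. of linear maps $D:\mathcal O(U)\to\mathcal O(U)$ such that $D(\mathcal O(U)_i)\subset\mathcal O(U)_j$ whenever $j-i=\alpha$ in $K(\mathcal I)$, $D(\mathcal O(U)_i)=0$ if there is no such $j$, and $$D(fg)=D(f)\,g+(-1)^{p(\alpha i)}f\,D(g)\qquad\text{for all } f\in\mathcal O(U)_i,\ g\in\mathcal O(U).$$ The space of vector fields on $U$ is $\mathfrak X(U)=\prod_{\alpha\in K(\mathcal I)}\mathfrak X(U)_\alpha$. Then, for every $\mathcal I$-graded manifold $\mathcal M=(M,\mathcal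 O)$: 1. For all open $V\subset U\subset M$, all $\alpha\in K(\mathcal I)$ and all $D\in\mathfrak X(U)_\alpha$ there is a unique $D'\in\mathfrak X(V)_\alpha$ with $D'(f|_V)=D(f)|_V$ for all $f\in\mathcal O(U)$. 2. With the restriction maps $D\mapsto D'$ (taken in each degree), $\mathfrak X$ is a presheaf of $K(\mathcal I)$-graded real vector spaces on $M$, and it is a sheaf: $\mathfrak X_\alpha$ is a sheaf of real vector spaces on $M$ for every $\alpha\in K(\mathcal I)$, and so is $\mathfrak X$. -/

import Mathlib

open CategoryTheory TopologicalSpace Opposite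
open scoped Manifold ContDiff

universe u w

noncomputable section

namespace MonGraded

/-! ### Signs -/

section Signs

variable {I : Type w} [NonUnitalCommSemiring I]

/-- The Grothendieck group `K(I)` of the additive monoid `(I, +)`. -/
abbrev GK (I : Type w) [NonUnitalCommSemiring I] : Type w := Algebra.GrothendieckAddGroup I

/-- The canonical map `I → K(I)`, `a ↦ [(a, 0)]`. -/
abbrev toGK : I →+ GK I := Algebra.GrothendieckAddGroup.of

/-- `parityMul p α i` is the parity `p (α i)`: on `α = [(j, k)]` it is `p (j i) + p (k i)`. -/
def parityMul (p : I →+ ZMod 2) (α : GK I) (i : I) : ZMod 2 :=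
  Algebra.GrothendieckAddGroup.lift (p.comp (AddMonoidHom.mulRight i)) α

/-- The sign `(-1) ^ a` for `a : ℤ / 2`. -/
def sgn (a : ZMod 2) : ℝ := (-1) ^ a.val

end Signs

/-! ### The symmetric algebra and its completion -/

section Sym

variable {I : Type w} [NonUnitalCommSemiring I]

/-- A homogeneous basis of the graded vector space `V = ⨁ i, ℝ ^ (m i)`;
the basis vector `⟨i, a⟩` has degree `i`. -/
abbrev Gen (m : I →₀ ℕ) : Type w := Σ i : I, Fin (m i)

/-- The relations `v ⊗ w = (-1) ^ p (d(v) d(w)) w ⊗ v` for basis vectors `v`, `w`. -/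
inductive SymRel (p : I →+ ZMod 2) (m : I →₀ ℕ) :
    FreeAlgebra ℝ (Gen m) → FreeAlgebra ℝ (Gen m) → Prop
  | swap (v w : Gen m) : SymRel p m
      (FreeAlgebra.ι ℝ v * FreeAlgebra.ι ℝ w)
      (sgn (p (v.1 * w.1)) • (FreeAlgebra.ι ℝ w * FreeAlgebra.ι ℝ v))

/-- The symmetric algebra `S(V)`: the tensor algebra of `V` (the free algebra on a basis of `V`)
modulo graded commutativity. -/
abbrev Sym (p : I →+ ZMod 2) (m : I →₀ ℕ) : Type w := RingQuot (SymRel p m)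

variable (p : I →+ ZMod 2) (m : I →₀ ℕ)

/-- The image of a basis vector of `V` in `S(V)`. -/
def symGen (v : Gen m) : Sym p m := RingQuot.mkAlgHom ℝ (SymRel p m) (FreeAlgebra.ι ℝ v)

/-- The monomial of a word in the basis vectors. -/
def symWord (l : List (Gen m)) : Sym p m := (l.map (symGen p m)).prod

/-- The degree in `I` of a word. -/
def wordDeg (l : List (Gen m)) : I := (l.map Sigma.fst).sum

/-- `S^n(V)`, spanned by the monomials of length `n`. -/
def symPow (n : ℕ) : Submodule ℝ (Sym p m) :=
  Submodule.span ℝ (symWord p m '' {l | l.length = n})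

/-- `S(V)_i`, spanned by the monomials of degree `i`. -/
def symDeg (i : I) : Submodule ℝ (Sym p m) :=
  Submodule.span ℝ (symWord p m '' {l | wordDeg m l = i})

lemma symWord_append (l l' : List (Gen m)) :
    symWord p m (l ++ l') = symWord p m l * symWord p m l' := by
  simp [symWord]

lemma wordDeg_append (l l' : List (Gen m)) :
    wordDeg m (l ++ l') = wordDeg m l + wordDeg m l' := by
  simp [wordDeg]

lemma finite_words (n : ℕ) : {l : List (Gen m) | l.length = n}.Finite := by
  have : Finite (Gen m) := by
    let f : Gen m → Σ i : m.support, Fin (m i) := fun v =>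
      ⟨⟨v.1, Finsupp.mem_support_iff.mpr fun h => (Fin.cast h v.2).elim0⟩, v.2⟩
    refine Finite.of_injective f ?_
    rintro ⟨i, a⟩ ⟨j, b⟩ h
    simp only [f, Sigma.mk.injEq, Subtype.mk.injEq] at h
    obtain ⟨rfl, h⟩ := h
    rw [eq_of_heq h]
  exact List.finite_length_eq _ n

lemma symPow_fg (n : ℕ) : (symPow p m n).FG :=
  Submodule.fg_span ((finite_words m n).image _)

lemma one_mem_symPow : (1 : Sym p m) ∈ symPow p m 0 :=
  Submodule.subset_span ⟨[], by simp, by simp [symWord]⟩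

lemma mul_mem_symPow {a b : ℕ} {x y : Sym p m} (hx : x ∈ symPow p m a) (hy : y ∈ symPow p m b) :
    x * y ∈ symPow p m (a + b) := by
  have h := Submodule.mul_mem_mul hx hy
  rw [symPow, symPow, Submodule.span_mul_span] at h
  refine Submodule.span_mono ?_ h
  rintro _ ⟨_, ⟨l, hl, rfl⟩, _, ⟨l', hl', rfl⟩, rfl⟩
  refine ⟨l ++ l', ?_, symWord_append p m l l'⟩
  simp only [Set.mem_ofPred_eq] at hl hl' ⊢
  simp [hl, hl']

instance symDeg_gradedMonoid : SetLike.GradedMonoid (symDeg p m) where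
  one_mem := Submodule.subset_span ⟨[], by simp [wordDeg], by simp [symWord]⟩
  mul_mem i j x y hx hy := by
    have h := Submodule.mul_mem_mul hx hy
    rw [symDeg, symDeg, Submodule.span_mul_span] at h
    refine Submodule.span_mono ?_ h
    rintro _ ⟨_, ⟨l, hl, rfl⟩, _, ⟨l', hl', rfl⟩, rfl⟩
    refine ⟨l ++ l', ?_, symWord_append p m l l'⟩
    simp only [Set.mem_ofPred_eq] at hl hl' ⊢
    rw [wordDeg_append, hl, hl']

lemma symGen_mem (v : Gen m) : symGen p m v ∈ symDeg p m v.1 :=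
  Submodule.subset_span ⟨[v], by simp [wordDeg], by simp [symWord]⟩

lemma symGen_comm (v w : Gen m) :
    symGen p m v * symGen p m w = sgn (p (v.1 * w.1)) • (symGen p m w * symGen p m v) := by
  have h := RingQuot.mkAlgHom_rel ℝ (SymRel.swap (p := p) v w)
  simpa only [symGen, map_mul, map_smul] using h

lemma symWord_mem (l : List (Gen m)) : symWord p m l ∈ symDeg p m (wordDeg m l) :=
  Submodule.subset_span ⟨l, rfl, rfl⟩

/-- The map `S(V) → ⨁ i, S(V)_i` that gives the decomposition into homogeneous components. -/
def symDecomp [DecidableEq I] : Sym p m →ₐ[ℝ] DirectSum I (fun i => symDeg p m i) :=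
  RingQuot.liftAlgHom ℝ ⟨FreeAlgebra.lift ℝ fun v =>
    DirectSum.of (fun i => symDeg p m i) v.1 ⟨symGen p m v, symGen_mem p m v⟩, by
    rintro _ _ ⟨v, w⟩
    simp only [map_mul, map_smul, FreeAlgebra.lift_ι_apply]
    rw [DirectSum.of_mul_of, DirectSum.of_mul_of]
    rw [← DirectSum.lof_eq_of ℝ, ← DirectSum.lof_eq_of ℝ, ← map_smul, DirectSum.lof_eq_of,
      DirectSum.lof_eq_of]
    refine DirectSum.of_eq_of_gradedMonoid_eq ?_
    refine Sigma.subtype_ext (add_comm _ _) ?_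
    exact symGen_comm p m v w⟩

lemma symDecomp_gen [DecidableEq I] (v : Gen m) : symDecomp p m (symGen p m v) =
    DirectSum.of (fun i => symDeg p m i) v.1 ⟨symGen p m v, symGen_mem p m v⟩ := by
  simp [symDecomp, symGen]

lemma symDecomp_word [DecidableEq I] (l : List (Gen m)) : symDecomp p m (symWord p m l) =
    DirectSum.of (fun i => symDeg p m i) (wordDeg m l)
      ⟨symWord p m l, symWord_mem p m l⟩ := by
  induction l with
  | nil =>
    have h : symWord p m [] = 1 := by simp [symWord]
    trans 1
    · rw [h, map_one]
    · refine DirectSum.of_eq_of_gradedMonoid_eq (Sigma.subtype_ext ?_ ?_)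
      · exact (List.sum_nil (α := I)).symm
      · exact h.symm
  | cons v l ih =>
    have h : symWord p m (v :: l) = symGen p m v * symWord p m l := by simp [symWord]
    trans symDecomp p m (symGen p m v) * symDecomp p m (symWord p m l)
    · rw [h, map_mul]
    rw [ih, symDecomp_gen, DirectSum.of_mul_of]
    refine DirectSum.of_eq_of_gradedMonoid_eq (Sigma.subtype_ext ?_ ?_)
    · exact List.sum_cons.symm
    · exact h.symm

/-- The direct sum decomposition `S(V) = ⨁ i, S(V)_i` as an `I`-graded algebra. -/
instance symGradedAlgebra [DecidableEq I] : GradedAlgebra (symDeg p m) :=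
  GradedAlgebra.ofAlgHom (symDeg p m) (symDecomp p m)
    (by
      apply RingQuot.ringQuot_ext' ℝ
      refine FreeAlgebra.hom_ext (funext fun v => ?_)
      change DirectSum.coeAlgHom (symDeg p m) (symDecomp p m (symGen p m v)) = symGen p m v
      rw [symDecomp_gen]
      simp)
    (by
      rintro i ⟨x, hx⟩
      induction hx using Submodule.span_induction with
      | mem x h =>
        obtain ⟨l, rfl, rfl⟩ := h
        exact symDecomp_word p m l
      | zero => simp only [map_zero]; exact (map_zero (DirectSum.of _ i)).symm
      | add x y hx hy h h' =>
        change symDecomp p m x = DirectSum.of _ i (⟨x, hx⟩ : symDeg p m i) at h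
        change symDecomp p m y = DirectSum.of _ i (⟨y, hy⟩ : symDeg p m i) at h'
        change symDecomp p m (x + y) = _
        rw [map_add, h, h', ← map_add]
        rfl
      | smul c x hx h =>
        change symDecomp p m x = DirectSum.of _ i (⟨x, hx⟩ : symDeg p m i) at h
        change symDecomp p m (c • x) = _
        rw [map_smul, h, ← DirectSum.lof_eq_of ℝ, ← map_smul]
        rfl)

open scoped Classical in
/-- The projection of `S(V)` onto its homogeneous component `S(V)_i`. -/
def symProj (i : I) : Sym p m →ₗ[ℝ] Sym p m := GradedAlgebra.proj (symDeg p m) i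

open scoped Classical in
lemma symProj_of_mem (i : I) {x : Sym p m} (hx : x ∈ symDeg p m i) : symProj p m i x = x := by
  rw [symProj, GradedAlgebra.proj_apply]
  exact DirectSum.decompose_of_mem_same _ hx

open scoped Classical in
lemma symProj_of_mem_ne {i j : I} {x : Sym p m} (hx : x ∈ symDeg p m j) (h : j ≠ i) :
    symProj p m i x = 0 := by
  rw [symProj, GradedAlgebra.proj_apply]
  exact DirectSum.decompose_of_mem_ne _ hx h

open scoped Classical in
lemma symProj_mem (i : I) (x : Sym p m) : symProj p m i x ∈ symDeg p m i := by
  rw [symProj, GradedAlgebra.proj_apply]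
  exact SetLike.coe_mem _

lemma symProj_word [DecidableEq I] (i : I) (l : List (Gen m)) :
    symProj p m i (symWord p m l) = if wordDeg m l = i then symWord p m l else 0 := by
  split_ifs with hi
  · subst hi
    exact symProj_of_mem p m _ (symWord_mem p m l)
  · exact symProj_of_mem_ne p m (symWord_mem p m l) hi

lemma symProj_mem_symPow (i : I) {n : ℕ} {x : Sym p m} (hx : x ∈ symPow p m n) :
    symProj p m i x ∈ symPow p m n := by
  classical
  induction hx using Submodule.span_induction with
  | mem x h =>
    obtain ⟨l, hl, rfl⟩ := h
    rw [symProj_word]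
    split_ifs
    · exact Submodule.subset_span ⟨l, hl, rfl⟩
    · exact zero_mem _
  | zero => simp
  | add x y _ _ h h' => rw [map_add]; exact add_mem h h'
  | smul c x _ h => rw [map_smul]; exact Submodule.smul_mem _ c h

lemma symProj_self (i : I) (x : Sym p m) : symProj p m i (symProj p m i x) = symProj p m i x :=
  symProj_of_mem p m i (symProj_mem p m i x)

lemma symProj_ne {i j : I} (h : i ≠ j) (x : Sym p m) : symProj p m i (symProj p m j x) = 0 :=
  symProj_of_mem_ne p m (symProj_mem p m j x) h.symm

lemma symProj_mul (i j : I) {x y : Sym p m} (hx : symProj p m i x = x)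
    (hy : symProj p m j y = y) : symProj p m (i + j) (x * y) = x * y := by
  refine symProj_of_mem p m _ (SetLike.mul_mem_graded ?_ ?_)
  · rw [← hx]; exact symProj_mem p m i x
  · rw [← hy]; exact symProj_mem p m j y

lemma symProj_one : symProj p m 0 1 = 1 :=
  symProj_of_mem p m 0 (SetLike.one_mem_graded (symDeg p m))

/-- Only finitely many degrees occur in `S^n(V)`. -/
lemma exists_degrees (n : ℕ) : ∃ s : Finset I, ∀ x ∈ symPow p m n,
    (∀ i ∉ s, symProj p m i x = 0) ∧ ∑ i ∈ s, symProj p m i x = x := by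
  classical
  refine ⟨((finite_words m n).image (wordDeg m)).toFinset, fun x hx => ?_⟩
  induction hx using Submodule.span_induction with
  | mem x h =>
    obtain ⟨l, hl, rfl⟩ := h
    have hs : wordDeg m l ∈ ((finite_words m n).image (wordDeg m)).toFinset :=
      (Set.Finite.mem_toFinset _).mpr ⟨l, hl, rfl⟩
    refine ⟨fun i hi => ?_, ?_⟩
    · rw [symProj_word, if_neg]
      rintro rfl
      exact hi hs
    · simp_rw [symProj_word]
      rw [Finset.sum_ite_eq, if_pos hs]
  | zero => simp
  | add x y _ _ h h' =>
    refine ⟨fun i hi => by rw [map_add, h.1 i hi, h'.1 i hi, add_zero], ?_⟩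
    simp_rw [map_add]
    rw [Finset.sum_add_distrib, h.2, h'.2]
  | smul c x _ h =>
    refine ⟨fun i hi => by rw [map_smul, h.1 i hi, smul_zero], ?_⟩
    simp_rw [map_smul]
    rw [← Finset.smul_sum, h.2]

end Sym

/-! ### Graded algebras in the completed sense -/

/-- An `I`-grading on a real algebra `A` which, like formal power series algebras, is complete:
`A` is the product of its subspaces `A_i` of homogeneous elements of degree `i`. Here `comp i` is
the projection of `A` onto `A_i`. -/
structure Grading (I : Type w) [AddCommMonoid I] (A : Type u) [Ring A] [Algebra ℝ A] where
  comp : I → A →ₗ[ℝ] A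
  comp_self : ∀ i x, comp i (comp i x) = comp i x
  comp_of_ne : ∀ i j x, i ≠ j → comp i (comp j x) = 0
  existsUnique : ∀ x : I → A, (∀ i, comp i (x i) = x i) → ∃! f : A, ∀ i, comp i f = x i
  one_mem : comp 0 1 = 1
  mul_mem : ∀ i j x y, comp i x = x → comp j y = y → comp (i + j) (x * y) = x * y

/-- The subspace `A_i` of homogeneous elements of degree `i`. -/
def Grading.homog {I : Type w} [AddCommMonoid I] {A : Type u} [Ring A] [Algebra ℝ A]
    (G : Grading I A) (i : I) : Submodule ℝ A := LinearMap.range (G.comp i)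

/-! ### Graded domains -/

section Domain

variable {I : Type w} [NonUnitalCommSemiring I]
variable (p : I →+ ZMod 2) (n : ℕ) (m : I →₀ ℕ)

lemma exists_coord {A : Type w} [AddCommGroup A] [Module ℝ A] (N : Submodule ℝ A) (hN : N.FG) :
    ∃ (k : ℕ) (b : Fin k → A) (c : Fin k → A →ₗ[ℝ] ℝ), ∀ a ∈ N, a = ∑ j, c j a • b j := by
  have : Module.Finite ℝ N := Module.Finite.iff_fg.mpr hN
  let B := Module.finBasis ℝ N
  obtain ⟨π, hπ⟩ := N.subtype.exists_leftInverse_of_injective (by simp)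
  refine ⟨_, fun j => (B j : A), fun j => (B.coord j).comp π, fun a ha => ?_⟩
  have h1 : π a = ⟨a, ha⟩ := LinearMap.congr_fun hπ ⟨a, ha⟩
  have h2 := congrArg N.subtype (B.sum_repr ⟨a, ha⟩)
  simp only [map_sum, map_smul, Submodule.subtype_apply] at h2
  simp only [LinearMap.comp_apply, h1, Module.Basis.coord_apply]
  exact h2.symm

/-- A function with values in the formal power series algebra `∏ k, S^k(V)` is smooth if all its
components, which take values in the finite dimensional spaces `S^k(V)`, are smooth, that is, if
they become smooth real functions when a linear functional is applied. -/
def IsSmooth {W : Opens (EuclideanSpace ℝ (Fin n))} (f : W → PowerSeries (Sym p m)) : Prop :=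
  ∀ k, (∀ x, PowerSeries.coeff k (f x) ∈ symPow p m k) ∧
    ∀ l : Sym p m →ₗ[ℝ] ℝ,
      ContMDiff (𝓡 n) 𝓘(ℝ, ℝ) ∞ (fun x : W => l (PowerSeries.coeff k (f x)))

/-- The algebra of smooth functions on `W` with values in the formal power series
algebra `∏ k, S^k(V)`. A family `(s_k)` with `s_k ∈ S^k(V)` is encoded as the power series
`∑ s_k X^k` over `S(V)`, so that the multiplication is the canonical one. -/
def domAlg (W : Opens (EuclideanSpace ℝ (Fin n))) :
    Subalgebra ℝ (W → PowerSeries (Sym p m)) where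
  carrier := {f | IsSmooth p n m f}
  add_mem' {f g} hf hg k := by
    refine ⟨fun x => ?_, fun l => ?_⟩
    · simpa using add_mem ((hf k).1 x) ((hg k).1 x)
    · simp only [Pi.add_apply, map_add]
      exact ((hf k).2 l).add ((hg k).2 l)
  mul_mem' {f g} hf hg k := by
    refine ⟨fun x => ?_, fun l => ?_⟩
    · simp only [Pi.mul_apply, PowerSeries.coeff_mul]
      refine sum_mem fun q hq => ?_
      rw [← Finset.HasAntidiagonal.mem_antidiagonal.mp hq]
      exact mul_mem_symPow p m ((hf _).1 x) ((hg _).1 x)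
    · simp only [Pi.mul_apply, PowerSeries.coeff_mul, map_sum]
      refine contMDiff_finsetSum fun q _ => ?_
      obtain ⟨a, b, c, h⟩ := exists_coord _ (symPow_fg p m q.1)
      obtain ⟨a', b', c', h'⟩ := exists_coord _ (symPow_fg p m q.2)
      have key : ∀ x, l (PowerSeries.coeff q.1 (f x) * PowerSeries.coeff q.2 (g x)) =
          ∑ j, ∑ j', c j (PowerSeries.coeff q.1 (f x)) * c' j' (PowerSeries.coeff q.2 (g x)) *
            l (b j * b' j') := fun x => by
        conv_lhs => rw [h _ ((hf q.1).1 x), h' _ ((hg q.2).1 x)]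
        simp only [Finset.sum_mul_sum, map_sum, smul_mul_smul_comm, map_smul, smul_eq_mul]
      simp only [key]
      refine contMDiff_finsetSum fun j _ => contMDiff_finsetSum fun j' _ => ?_
      exact (((hf q.1).2 (c j)).mul ((hg q.2).2 (c' j'))).mul contMDiff_const
  algebraMap_mem' r k := by
    refine ⟨fun x => ?_, fun l => contMDiff_const (c := l (PowerSeries.coeff k (algebraMap ℝ _ r)))⟩
    simp only [Pi.algebraMap_apply, Algebra.algebraMap_eq_smul_one, PowerSeries.coeff_smul,
      PowerSeries.coeff_one]
    split_ifs with hk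
    · subst hk
      exact Submodule.smul_mem _ _ (one_mem_symPow p m)
    · simp

/-- Restriction of smooth functions. -/
def domRes {W W' : Opens (EuclideanSpace ℝ (Fin n))} (h : W' ≤ W) :
    domAlg p n m W →ₐ[ℝ] domAlg p n m W' where
  toFun f := ⟨fun x => f.1 ⟨x.1, h x.2⟩, fun k =>
    ⟨fun _ => (f.2 k).1 _, fun l => ((f.2 k).2 l).comp (contMDiff_inclusion h)⟩⟩
  map_one' := rfl
  map_mul' _ _ := rfl
  map_zero' := rfl
  map_add' _ _ := rfl
  commutes' _ := rfl

/-- The projection of `domAlg` onto homogeneous functions of degree `i`. -/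
def domComp (W : Opens (EuclideanSpace ℝ (Fin n))) (i : I) :
    domAlg p n m W →ₗ[ℝ] domAlg p n m W where
  toFun f := ⟨fun x => PowerSeries.mk fun k => symProj p m i (PowerSeries.coeff k (f.1 x)),
    fun k => by
      simp only [PowerSeries.coeff_mk]
      exact ⟨fun x => symProj_mem_symPow p m i ((f.2 k).1 x),
        fun l => (f.2 k).2 (l.comp (symProj p m i))⟩⟩
  map_add' f g := by
    refine Subtype.ext (funext fun x => PowerSeries.ext fun k => ?_)
    simp
  map_smul' c f := by
    refine Subtype.ext (funext fun x => PowerSeries.ext fun k => ?_)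
    simp

lemma coeff_domComp (W : Opens (EuclideanSpace ℝ (Fin n))) (i : I) (f : domAlg p n m W) (x : W)
    (k : ℕ) : PowerSeries.coeff k ((domComp p n m W i f).1 x) =
      symProj p m i (PowerSeries.coeff k (f.1 x)) := by
  simp [domComp]

lemma domAlg_ext {W : Opens (EuclideanSpace ℝ (Fin n))} {f g : domAlg p n m W}
    (h : ∀ x k, PowerSeries.coeff k (f.1 x) = PowerSeries.coeff k (g.1 x)) : f = g :=
  Subtype.ext (funext fun x => PowerSeries.ext fun k => h x k)

/-- The grading of the algebra of functions on a graded domain. -/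
def domGrading (W : Opens (EuclideanSpace ℝ (Fin n))) : Grading I (domAlg p n m W) where
  comp := domComp p n m W
  comp_self i f := domAlg_ext p n m fun x k => by
    simp only [coeff_domComp, symProj_self]
  comp_of_ne i j f h := domAlg_ext p n m fun x k => by
    rw [coeff_domComp, coeff_domComp, symProj_ne p m h]
    simp
  existsUnique f hf := by
    have hf' : ∀ i x k, symProj p m i (PowerSeries.coeff k ((f i).1 x)) =
        PowerSeries.coeff k ((f i).1 x) := fun i x k => by
      rw [← coeff_domComp, hf]
    choose s hs using exists_degrees p m
    refine ⟨⟨fun x => PowerSeries.mk fun k => ∑ i ∈ s k, PowerSeries.coeff k ((f i).1 x),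
      fun k => ?_⟩, fun j => domAlg_ext p n m fun x k => ?_, fun g hg =>
      domAlg_ext p n m fun x k => ?_⟩
    · simp only [PowerSeries.coeff_mk, map_sum]
      exact ⟨fun x => sum_mem fun i _ => ((f i).2 k).1 x,
        fun l => contMDiff_finsetSum fun i _ => ((f i).2 k).2 l⟩
    · rw [coeff_domComp]
      simp only [PowerSeries.coeff_mk, map_sum]
      by_cases hj : j ∈ s k
      · rw [Finset.sum_eq_single_of_mem j hj, hf']
        intro i _ hij
        rw [← hf' i x k, symProj_ne p m hij.symm]
      · rw [← hf' j x k, (hs k _ (((f j).2 k).1 x)).1 j hj]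
        refine Finset.sum_eq_zero fun i hi => ?_
        rw [← hf' i x k, symProj_ne p m]
        rintro rfl
        exact hj hi
    · simp only [PowerSeries.coeff_mk]
      rw [← (hs k _ ((g.2 k).1 x)).2]
      refine Finset.sum_congr rfl fun i _ => ?_
      rw [← coeff_domComp, hg]
  one_mem := domAlg_ext p n m fun x k => by
    rw [coeff_domComp]
    simp only [OneMemClass.coe_one, Pi.one_apply, PowerSeries.coeff_one]
    split_ifs
    · exact symProj_one p m
    · simp
  mul_mem i j f g hf hg := domAlg_ext p n m fun x k => by
    rw [coeff_domComp]
    simp only [MulMemClass.coe_mul, Pi.mul_apply, PowerSeries.coeff_mul, map_sum]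
    refine Finset.sum_congr rfl fun q _ => symProj_mul p m i j ?_ ?_
    · rw [← coeff_domComp, hf]
    · rw [← coeff_domComp, hg]

end Domain

/-! ### Graded ringed spaces and graded manifolds -/

section Manifold

variable {I : Type w} [NonUnitalCommSemiring I]

/-- A sheaf of real algebras on `X` with compatible `I`-gradings of its algebras of sections. -/
structure GradedRingedSpace (I : Type w) [NonUnitalCommSemiring I] (X : TopCat.{u}) where
  sheaf : TopCat.Sheaf (AlgCat.{u} ℝ) X
  grading : ∀ U : Opens X, Grading I (sheaf.presheaf.obj (op U))
  comp_map : ∀ {U V : Opens X} (h : V ≤ U) (i : I) (f : sheaf.presheaf.obj (op U)),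
    (grading V).comp i ((sheaf.presheaf.map (homOfLE h).op).hom f) =
      (sheaf.presheaf.map (homOfLE h).op).hom ((grading U).comp i f)

namespace GradedRingedSpace

variable {X : TopCat.{u}} (O : GradedRingedSpace I X)

/-- The algebra of sections over `U`. -/
abbrev Sec (U : Opens X) : Type u := O.sheaf.presheaf.obj (op U)

/-- The restriction morphism. -/
def res {U V : Opens X} (h : V ≤ U) : O.Sec U →ₐ[ℝ] O.Sec V :=
  (O.sheaf.presheaf.map (homOfLE h).op).hom

/-- The homogeneous sections of degree `i` over `U`. -/
abbrev homog (U : Opens X) (i : I) : Submodule ℝ (O.Sec U) := (O.grading U).homog i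

end GradedRingedSpace

/-- The part of the source of a partial homeomorphism that is mapped to `W`. -/
def pullOpen {X : TopCat.{u}} {n : ℕ} (e : OpenPartialHomeomorph X (EuclideanSpace ℝ (Fin n)))
    (W : Opens (EuclideanSpace ℝ (Fin n))) : Opens X :=
  ⟨e.source ∩ e ⁻¹' W, e.isOpen_inter_preimage W.isOpen⟩

lemma pullOpen_mono {X : TopCat.{u}} {n : ℕ}
    (e : OpenPartialHomeomorph X (EuclideanSpace ℝ (Fin n)))
    {W W' : Opens (EuclideanSpace ℝ (Fin n))} (h : W' ≤ W) : pullOpen e W' ≤ pullOpen e W :=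
  fun _ hx => ⟨hx.1, h hx.2⟩

/-- A chart: a homeomorphism of an open subset of `X` onto an open subset of `ℝ ^ n`, together
with an isomorphism of sheaves of `I`-graded algebras with the structure sheaf of the
graded domain. -/
structure Chart {X : TopCat.{u}} (O : GradedRingedSpace I X) (p : I →+ ZMod 2) (n : ℕ)
    (m : I →₀ ℕ) where
  homeo : OpenPartialHomeomorph X (EuclideanSpace ℝ (Fin n))
  iso : ∀ W : Opens (EuclideanSpace ℝ (Fin n)),
    (W : Set (EuclideanSpace ℝ (Fin n))) ⊆ homeo.target →
    (O.Sec (pullOpen homeo W) ≃ₐ[ℝ] domAlg p n m W)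
  iso_comp : ∀ W hW i f, iso W hW ((O.grading _).comp i f) = (domGrading p n m W).comp i (iso W hW f)
  iso_res : ∀ {W W' : Opens (EuclideanSpace ℝ (Fin n))} (h : W' ≤ W) hW hW' f,
    iso W' hW' (O.res (pullOpen_mono homeo h) f) = domRes p n m h (iso W hW f)

/-- An `I`-graded manifold of dimension `n | (m i)` over `X`, where `V_0 = 0`. The charts make `X`
locally Euclidean of dimension `n`; its smooth structure is the one determined by the sheaf. -/
structure GradedManifold (p : I →+ ZMod 2) (n : ℕ) (m : I →₀ ℕ) (X : TopCat.{u})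
    extends GradedRingedSpace I X where
  dim_zero : m 0 = 0
  exists_chart : ∀ x : X, ∃ c : Chart toGradedRingedSpace p n m, x ∈ c.homeo.source

end Manifold

/-! ### Vector fields -/

section VectorFields

variable {I : Type w} [NonUnitalCommSemiring I] {X : TopCat.{u}}

/-- Derivations `D` of degree `α ∈ K(I)` of the graded algebra `O(U)`: linear endomorphisms with
`D (O(U)_i) ⊆ O(U)_j` whenever `j - i = α` in `K(I)`, with `D (O(U)_i) = 0` if there is no such `j`,
and with `D (f g) = D(f) g + (-1) ^ p (α d(f)) f D(g)` for homogeneous `f` and arbitrary `g`. -/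
def homDer (p : I →+ ZMod 2) (O : GradedRingedSpace I X) (U : Opens X) (α : GK I) :
    Submodule ℝ (Module.End ℝ (O.Sec U)) where
  carrier := {D |
    (∀ i j, toGK j = α + toGK i → ∀ f ∈ O.homog U i, D f ∈ O.homog U j) ∧
    (∀ i, (∀ j, toGK j ≠ α + toGK i) → ∀ f ∈ O.homog U i, D f = 0) ∧
    ∀ i, ∀ f ∈ O.homog U i, ∀ g, D (f * g) = D f * g + sgn (parityMul p α i) • (f * D g)}
  add_mem' {D E} hD hE := by
    refine ⟨fun i j h f hf => add_mem (hD.1 i j h f hf) (hE.1 i j h f hf), fun i h f hf => ?_,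
      fun i f hf g => ?_⟩
    · rw [LinearMap.add_apply, hD.2.1 i h f hf, hE.2.1 i h f hf, add_zero]
    · simp only [LinearMap.add_apply, hD.2.2 i f hf g, hE.2.2 i f hf g, add_mul, mul_add, smul_add]
      abel
  zero_mem' := by
    refine ⟨fun _ _ _ _ _ => zero_mem _, fun _ _ _ _ => rfl, fun _ _ _ _ => ?_⟩
    simp
  smul_mem' c D hD := by
    refine ⟨fun i j h f hf => Submodule.smul_mem _ c (hD.1 i j h f hf), fun i h f hf => ?_,
      fun i f hf g => ?_⟩
    · rw [LinearMap.smul_apply, hD.2.1 i h f hf, smul_zero]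
    · simp only [LinearMap.smul_apply, hD.2.2 i f hf g, smul_add, smul_mul_assoc, mul_smul_comm]
      rw [smul_comm]

/-- `D'` is the restriction to `V` of the endomorphism `D` of `O(U)`. -/
def IsRestriction (O : GradedRingedSpace I X) {U V : Opens X} (h : V ≤ U)
    (D : Module.End ℝ (O.Sec U)) (D' : Module.End ℝ (O.Sec V)) : Prop :=
  ∀ f, D' (O.res h f) = O.res h (D f)

/-- The structure of a presheaf on vector fields given by restricting derivations. -/
structure Restrictions (p : I →+ ZMod 2) (O : GradedRingedSpace I X) where
  map : ∀ {U V : Opens X}, V ≤ U → ∀ α : GK I, homDer p O U α →ₗ[ℝ] homDer p O V α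
  isRestriction : ∀ {U V : Opens X} (h : V ≤ U) α (D : homDer p O U α),
    IsRestriction O h D.1 (map h α D).1
  map_id : ∀ (U : Opens X) α, map (le_refl U) α = LinearMap.id
  map_comp : ∀ {U V W : Opens X} (h : V ≤ U) (h' : W ≤ V) α,
    map (h'.trans h) α = (map h' α).comp (map h α)

namespace Restrictions

variable {p : I →+ ZMod 2} {O : GradedRingedSpace I X} (R : Restrictions p O)

/-- The presheaf of vector fields of degree `α`. -/
def presheafDeg (α : GK I) : TopCat.Presheaf (ModuleCat.{u} ℝ) X where
  obj U := ModuleCat.of ℝ (homDer p O U.unop α)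
  map f := ModuleCat.ofHom (R.map (leOfHom f.unop) α)
  map_id U := by
    rw [R.map_id]
    rfl
  map_comp f g := by
    rw [← ModuleCat.ofHom_comp, ← R.map_comp]

/-- The presheaf `𝔛` of all vector fields. In accordance with the convention for gradings, `𝔛(U)` is
the product of the spaces `𝔛(U)_α` of derivations of degree `α` of `O(U)`, for `α ∈ K(I)`: a vector
field is the (possibly infinite) sum `∑ α, D α` of its homogeneous components. -/
def presheaf : TopCat.Presheaf (ModuleCat.{max u w} ℝ) X where
  obj U := ModuleCat.of ℝ (∀ α : GK I, homDer p O U.unop α)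
  map f := ModuleCat.ofHom (LinearMap.pi fun α => (R.map (leOfHom f.unop) α).comp
    (LinearMap.proj α))
  map_id U := by
    simp only [R.map_id]
    rfl
  map_comp f g := by
    rw [← ModuleCat.ofHom_comp]
    congr 1
    refine LinearMap.ext fun D => funext fun α => ?_
    exact LinearMap.congr_fun (R.map_comp (leOfHom f.unop) (leOfHom g.unop) α) (D α)

end Restrictions

end VectorFields

end MonGraded

end

/-!
On a graded manifold, a bump function in a chart, extended by zero (the space being Hausdorff), is
a section `b` of degree `0`, so that the Leibniz rule `D (b f) = D(b) f + b D(f)` involves no sign.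
If `f` vanishes on `V` and `b` is supported in `V`, then `b f = 0`, hence `D f` vanishes wherever
`b = 1` and `f = 0`: derivations are local operators. With bump functions, a section over `V ⊆ U`
agrees near each point of `V` with a section over `U`. The values of a local operator on these
local extensions glue, which gives its unique restriction to `V`. The conditions that define
derivations of degree `α` can be tested locally, so restrictions and gluings of derivations are
derivations.
-/

noncomputable section

namespace MonGraded

lemma exists_linearMap_of_existsUnique {R E F : Type*} [Semiring R] [AddCommMonoid E]
    [Module R E] [AddCommMonoid F] [Module R F] (G : Submodule R (E × F))
    (hG : ∀ x, ∃! y, (x, y) ∈ G) :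
    ∃ f : E →ₗ[R] F, ∀ x, (x, f x) ∈ G := by
  have hbij : Function.Bijective (Prod.fst ∘ G.subtype) := by
    refine ⟨?_, fun x => ⟨⟨_, (hG x).exists.choose_spec⟩, rfl⟩⟩
    rintro ⟨⟨x, y⟩, hy⟩ ⟨⟨_, y'⟩, hy'⟩ rfl
    exact Subtype.ext (Prod.ext rfl ((hG _).unique hy hy'))
  obtain ⟨f, rfl⟩ := Submodule.exists_eq_graph hbij
  exact ⟨f, fun x => (LinearMap.mem_graph_iff f (x, f x)).2 rfl⟩

variable {I : Type w} [NonUnitalCommSemiring I] {X : TopCat.{u}}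

namespace GradedRingedSpace

section Sections

variable (O : GradedRingedSpace I X)

lemma res_res {U V W : Opens X} (h : V ≤ U) (h' : W ≤ V) (f : O.Sec U) :
    O.res h' (O.res h f) = O.res (h'.trans h) f := by
  have hcomp : (homOfLE (h'.trans h)).op = (homOfLE h).op ≫ (homOfLE h').op := rfl
  simp only [res, hcomp, Functor.map_comp, AlgCat.hom_comp, AlgHom.comp_apply]

lemma res_self {U : Opens X} (f : O.Sec U) : O.res le_rfl f = f := by
  have hid : (homOfLE (le_refl U)).op = 𝟙 (op U) := rfl
  simp only [res, hid, CategoryTheory.Functor.map_id, AlgCat.hom_id, AlgHom.id_apply]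

variable {O}

lemma res_eq_res_of_le {U V W W' : Opens X} {hU : W ≤ U} {hV : W ≤ V} {f : O.Sec U} {g : O.Sec V}
    (hfg : O.res hU f = O.res hV g) (h : W' ≤ W) :
    O.res (h.trans hU) f = O.res (h.trans hV) g := by
  rw [← res_res O hU h, hfg, res_res]

lemma eq_of_cover {ι : Type*} {U : Opens X} {V : ι → Opens X} (hV : ∀ a, V a ≤ U)
    (hc : U ≤ iSup V) {f g : O.Sec U} (hfg : ∀ a, O.res (hV a) f = O.res (hV a) g) : f = g :=
  O.sheaf.eq_of_locally_eq' V U (fun a => homOfLE (hV a)) hc f g hfg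

lemma eq_of_locally_eq {U : Opens X} {f g : O.Sec U}
    (hfg : ∀ x ∈ U, ∃ (V : Opens X) (h : V ≤ U), x ∈ V ∧ O.res h f = O.res h g) : f = g := by
  choose V h hx hV using fun x : U => hfg x.1 x.2
  exact eq_of_cover h (fun x hxU => Opens.mem_iSup.2 ⟨⟨x, hxU⟩, hx _⟩) hV

lemma exists_glue {ι : Type*} {U : Opens X} {V : ι → Opens X} (hV : ∀ a, V a ≤ U)
    (hc : U ≤ iSup V) (s : ∀ a, O.Sec (V a))
    (hs : ∀ a b, O.res (inf_le_left : V a ⊓ V b ≤ V a) (s a) =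
      O.res (inf_le_right : V a ⊓ V b ≤ V b) (s b)) :
    ∃ f : O.Sec U, ∀ a, O.res (hV a) f = s a :=
  (O.sheaf.existsUnique_gluing' V U (fun a => homOfLE (hV a)) hc s hs).exists

lemma mem_homog_iff {U : Opens X} {i : I} {f : O.Sec U} :
    f ∈ O.homog U i ↔ (O.grading U).comp i f = f := by
  constructor
  · rintro ⟨g, rfl⟩
    exact (O.grading U).comp_self i g
  · exact fun h => ⟨f, h⟩

lemma mul_mem_homog {U : Opens X} {i j : I} {f g : O.Sec U} (hf : f ∈ O.homog U i)
    (hg : g ∈ O.homog U j) : f * g ∈ O.homog U (i + j) := by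
  rw [mem_homog_iff] at *
  exact (O.grading U).mul_mem i j f g hf hg

lemma comp_res {U V : Opens X} (h : V ≤ U) (i : I) (f : O.Sec U) :
    (O.grading V).comp i (O.res h f) = O.res h ((O.grading U).comp i f) :=
  O.comp_map h i f

lemma res_mem_homog {U V : Opens X} (h : V ≤ U) {i : I} {f : O.Sec U} (hf : f ∈ O.homog U i) :
    O.res h f ∈ O.homog V i := by
  rw [mem_homog_iff] at hf ⊢
  rw [comp_res, hf]

lemma mem_homog_of_locally {U : Opens X} {i : I} {f : O.Sec U}
    (hf : ∀ x ∈ U, ∃ (V : Opens X) (h : V ≤ U), x ∈ V ∧ O.res h f ∈ O.homog V i) :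
    f ∈ O.homog U i := by
  rw [mem_homog_iff]
  refine eq_of_locally_eq fun x hx => ?_
  obtain ⟨V, h, hxV, hV⟩ := hf x hx
  exact ⟨V, h, hxV, by rw [← comp_res, mem_homog_iff.1 hV]⟩

lemma exists_extension_by_zero {U V Z : Opens X} (hV : V ≤ U) (hZ : Z ≤ U) (hc : U ≤ V ⊔ Z)
    (f : O.Sec V) (hf : O.res (inf_le_left : V ⊓ Z ≤ V) f = 0) :
    ∃ g : O.Sec U, O.res hV g = f ∧ O.res hZ g = 0 ∧ ∀ i, f ∈ O.homog V i → g ∈ O.homog U i := by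
  let C (b : Bool) : Opens X := cond b V Z
  let s : ∀ b, O.Sec (C b) := Bool.rec (0 : O.Sec Z) f
  obtain ⟨g, hg⟩ := exists_glue (V := C) (Bool.rec hZ hV)
    (hc.trans (sup_le (le_iSup C true) (le_iSup C false))) s (by
      have hf' : O.res (inf_le_right : Z ⊓ V ≤ V) f = 0 := by
        rw [← res_res O inf_le_left (inf_comm Z V).le, hf, map_zero]
      rintro (_ | _) (_ | _)
      · rfl
      · exact (map_zero _).trans hf'.symm
      · exact hf.trans (map_zero _).symm
      · rfl)
  have hgV : O.res hV g = f := hg true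
  have hgZ : O.res hZ g = 0 := hg false
  refine ⟨g, hgV, hgZ, fun i hi => mem_homog_of_locally fun x hx => ?_⟩
  rcases hc hx with hxV | hxZ
  · exact ⟨V, hV, hxV, hgV ▸ hi⟩
  · exact ⟨Z, hZ, hxZ, hgZ ▸ zero_mem _⟩

end Sections

section Bumps

variable {O : GradedRingedSpace I X}

variable (O) in
/-- Existence of bump functions: every neighbourhood `V` of a point `x` supports a global section
of degree `0` which is `1` near `x`. That its support lies in `V` is expressed by its vanishing on
an open set `Z` which together with `V` covers `X`. -/
def HasBumps : Prop :=
  ∀ (V : Opens X), ∀ x ∈ V, ∃ b ∈ O.homog ⊤ 0, ∃ W Z : Opens X, x ∈ W ∧ W ≤ V ∧ V ⊔ Z = ⊤ ∧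
    O.res (le_top : W ≤ ⊤) b = 1 ∧ O.res (le_top : Z ≤ ⊤) b = 0

lemma HasBumps.exists_local_extension (hO : O.HasBumps) {U V : Opens X} (h : V ≤ U) {x : X}
    (hx : x ∈ V) (g : O.Sec V) :
    ∃ (W : Opens X) (hW : W ≤ V) (G : O.Sec U), x ∈ W ∧
      O.res (hW.trans h) G = O.res hW g ∧ ∀ i, g ∈ O.homog V i → G ∈ O.homog U i := by
  obtain ⟨b, hb, W, Z, hxW, hWV, hVZ, hbW, hbZ⟩ := hO V x hx
  have hcover : U ≤ V ⊔ (U ⊓ Z) := by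
    rw [sup_inf_left, hVZ, inf_top_eq]
    exact le_sup_right
  obtain ⟨G, hGV, -, hGhomog⟩ := exists_extension_by_zero h inf_le_left hcover
    (O.res le_top b * g) (by
      have hZ : V ⊓ (U ⊓ Z) ≤ Z := inf_le_right.trans inf_le_right
      rw [map_mul, res_res, ← res_res O le_top hZ, hbZ, map_zero, zero_mul])
  refine ⟨W, hWV, G, hxW, ?_, fun i hi => hGhomog i ?_⟩
  · rw [← res_res O h hWV, hGV, map_mul, res_res, hbW, one_mul]
  · simpa only [zero_add] using mul_mem_homog (res_mem_homog le_top hb) hi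

lemma HasBumps.exists_mul_eq_zero (hO : O.HasBumps) {U V : Opens X} (h : V ≤ U) {x : X}
    (hx : x ∈ V) {f : O.Sec U} (hf : O.res h f = 0) :
    ∃ b ∈ O.homog U 0, b * f = 0 ∧
      ∃ (W : Opens X) (hW : W ≤ V), x ∈ W ∧ O.res (hW.trans h) b = 1 := by
  obtain ⟨b, hb, W, Z, hxW, hWV, hVZ, hbW, hbZ⟩ := hO V x hx
  refine ⟨O.res le_top b, res_mem_homog le_top hb, eq_of_locally_eq fun y hy => ?_, W, hWV, hxW,
    by rw [res_res, hbW]⟩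
  rcases (hVZ ▸ Opens.mem_top y : y ∈ V ⊔ Z) with hyV | hyZ
  · exact ⟨V, h, hyV, by rw [map_mul, hf, mul_zero, map_zero]⟩
  · refine ⟨U ⊓ Z, inf_le_left, ⟨hy, hyZ⟩, ?_⟩
    rw [map_mul, res_res, ← res_res O le_top inf_le_right, hbZ, map_zero, zero_mul, map_zero]

end Bumps

end GradedRingedSpace

open GradedRingedSpace

section LocalOperators

variable {O : GradedRingedSpace I X} {U V W : Opens X}

/-- Local operators on `O(U)`: those which do not increase supports. -/
def IsLocalOperator (D : Module.End ℝ (O.Sec U)) : Prop :=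
  ∀ ⦃V : Opens X⦄ (h : V ≤ U) (f : O.Sec U), O.res h f = 0 → O.res h (D f) = 0

lemma IsLocalOperator.res_congr {D : Module.End ℝ (O.Sec U)} (hD : IsLocalOperator D) (h : V ≤ U)
    {f g : O.Sec U} (hfg : O.res h f = O.res h g) : O.res h (D f) = O.res h (D g) := by
  rw [← sub_eq_zero, ← map_sub, ← map_sub]
  exact hD h _ (by rw [map_sub, hfg, sub_self])

lemma IsRestriction.trans {h : V ≤ U} {h' : W ≤ V} {D : Module.End ℝ (O.Sec U)}
    {D' : Module.End ℝ (O.Sec V)} {D'' : Module.End ℝ (O.Sec W)} (hD : IsRestriction O h D D')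
    (hD' : IsRestriction O h' D' D'') : IsRestriction O (h'.trans h) D D'' := fun f => by
  rw [← res_res O h h', hD', hD, res_res]

lemma IsRestriction.res_apply_eq {h : V ≤ U} {D : Module.End ℝ (O.Sec U)}
    {D' : Module.End ℝ (O.Sec V)} (hDD' : IsRestriction O h D D') (hD' : IsLocalOperator D')
    (hW : W ≤ V) {g : O.Sec V} {G : O.Sec U} (hG : O.res (hW.trans h) G = O.res hW g) :
    O.res hW (D' g) = O.res (hW.trans h) (D G) := by
  rw [← res_res O h hW, ← hDD']
  exact hD'.res_congr hW (by rw [res_res, hG])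

lemma IsRestriction.unique (hO : O.HasBumps) {h : V ≤ U} {D : Module.End ℝ (O.Sec U)}
    {D₁ D₂ : Module.End ℝ (O.Sec V)} (h₁ : IsRestriction O h D D₁) (h₂ : IsRestriction O h D D₂)
    (hD₁ : IsLocalOperator D₁) (hD₂ : IsLocalOperator D₂) : D₁ = D₂ := by
  refine LinearMap.ext fun g => eq_of_locally_eq fun x hx => ?_
  obtain ⟨W, hW, G, hxW, hG, -⟩ := hO.exists_local_extension h hx g
  exact ⟨W, hW, hxW, by rw [h₁.res_apply_eq hD₁ hW hG, h₂.res_apply_eq hD₂ hW hG]⟩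

/-- The graph of the restriction to `V` of a local operator `D` on `O(U)`: the pairs `(g, s)` of
sections over `V` such that, near every point, `g` extends to a section `G` over `U` for which `D G`
extends `s`. -/
def restrictionGraph (h : V ≤ U) (D : Module.End ℝ (O.Sec U)) :
    Submodule ℝ (O.Sec V × O.Sec V) where
  carrier := {q | ∀ x ∈ V, ∃ (W : Opens X) (hW : W ≤ V) (G : O.Sec U), x ∈ W ∧
    O.res (hW.trans h) G = O.res hW q.1 ∧ O.res (hW.trans h) (D G) = O.res hW q.2}
  add_mem' {q r} hq hr x hx := by
    obtain ⟨W, hW, G, hxW, hG, hDG⟩ := hq x hx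
    obtain ⟨W', hW', G', hxW', hG', hDG'⟩ := hr x hx
    refine ⟨W ⊓ W', inf_le_left.trans hW, G + G', ⟨hxW, hxW'⟩, ?_, ?_⟩
    · simp only [Prod.fst_add, map_add, res_eq_res_of_le hG inf_le_left,
        res_eq_res_of_le hG' inf_le_right]
    · simp only [Prod.snd_add, map_add, res_eq_res_of_le hDG inf_le_left,
        res_eq_res_of_le hDG' inf_le_right]
  zero_mem' x hx := ⟨V, le_rfl, 0, hx, by simp, by simp⟩
  smul_mem' c q hq x hx := by
    obtain ⟨W, hW, G, hxW, hG, hDG⟩ := hq x hx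
    exact ⟨W, hW, c • G, hxW, by simp only [Prod.smul_fst, map_smul, hG],
      by simp only [Prod.smul_snd, map_smul, hDG]⟩

lemma IsLocalOperator.res_eq_of_mem_restrictionGraph {h : V ≤ U} {D : Module.End ℝ (O.Sec U)}
    (hD : IsLocalOperator D) {g s : O.Sec V} (hs : (g, s) ∈ restrictionGraph h D) (hW : W ≤ V)
    {G : O.Sec U} (hG : O.res (hW.trans h) G = O.res hW g) :
    O.res hW s = O.res (hW.trans h) (D G) := by
  refine eq_of_locally_eq fun x hx => ?_
  obtain ⟨W', hW', G', hxW', hG', hDG'⟩ := hs x (hW hx)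
  refine ⟨W ⊓ W', inf_le_left, ⟨hx, hxW'⟩, ?_⟩
  rw [res_res, res_res, ← res_eq_res_of_le hDG' inf_le_right]
  refine hD.res_congr _ ?_
  exact (res_eq_res_of_le hG' inf_le_right).trans (res_eq_res_of_le hG inf_le_left).symm

lemma IsLocalOperator.existsUnique_mem_restrictionGraph (hO : O.HasBumps) (h : V ≤ U)
    {D : Module.End ℝ (O.Sec U)} (hD : IsLocalOperator D) (g : O.Sec V) :
    ∃! s, (g, s) ∈ restrictionGraph h D := by
  choose W hW G hxW hG _ using fun x : V => hO.exists_local_extension h x.2 g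
  have hcover : V ≤ iSup W := fun x hx => Opens.mem_iSup.2 ⟨⟨x, hx⟩, hxW _⟩
  obtain ⟨s, hs⟩ := exists_glue hW hcover (fun x => O.res ((hW x).trans h) (D (G x))) fun x y => by
    rw [res_res, res_res]
    refine hD.res_congr _ ?_
    exact (res_eq_res_of_le (hG x) inf_le_left).trans (res_eq_res_of_le (hG y) inf_le_right).symm
  refine ⟨s, fun x hx => ⟨W ⟨x, hx⟩, hW _, G _, hxW _, hG _, (hs _).symm⟩, fun t ht => ?_⟩
  refine eq_of_cover hW hcover fun x => ?_
  rw [hs, hD.res_eq_of_mem_restrictionGraph ht (hW x) (hG x)]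

lemma exists_isRestriction_of_cover {ι : Type*} {V : ι → Opens X} (hV : ∀ a, V a ≤ U)
    (hc : U ≤ iSup V) (D : ∀ a, Module.End ℝ (O.Sec (V a)))
    (hD : ∀ a b f, O.res (inf_le_left : V a ⊓ V b ≤ V a) (D a (O.res (hV a) f)) =
      O.res (inf_le_right : V a ⊓ V b ≤ V b) (D b (O.res (hV b) f))) :
    ∃ E : Module.End ℝ (O.Sec U), ∀ a, IsRestriction O (hV a) E (D a) := by
  let G : Submodule ℝ (O.Sec U × O.Sec U) :=
    { carrier := {q | ∀ a, D a (O.res (hV a) q.1) = O.res (hV a) q.2}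
      add_mem' := fun {q r} hq hr a => by
        simp only [Prod.snd_add, Prod.fst_add, map_add, hq a, hr a]
      zero_mem' := fun a => by simp only [Prod.fst_zero, Prod.snd_zero, map_zero]
      smul_mem' := fun c q hq a => by simp only [Prod.smul_snd, Prod.smul_fst, map_smul, hq a] }
  obtain ⟨E, hE⟩ := exists_linearMap_of_existsUnique G fun f => by
    obtain ⟨s, hs⟩ := exists_glue hV hc (fun a => D a (O.res (hV a) f)) fun a b => hD a b f
    exact ⟨s, fun a => (hs a).symm, fun t ht =>
      eq_of_cover hV hc fun a => (ht a).symm.trans (hs a).symm⟩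
  exact ⟨E, fun a f => hE f a⟩

theorem IsLocalOperator.existsUnique_restriction (hO : O.HasBumps) (h : V ≤ U)
    {D : Module.End ℝ (O.Sec U)} (hD : IsLocalOperator D) :
    ∃! D' : Module.End ℝ (O.Sec V), IsLocalOperator D' ∧ IsRestriction O h D D' := by
  obtain ⟨D', hD'⟩ := exists_linearMap_of_existsUnique (restrictionGraph h D)
    (hD.existsUnique_mem_restrictionGraph hO h)
  have hlocal : IsLocalOperator D' := fun W hW g hg => by
    rw [hD.res_eq_of_mem_restrictionGraph (hD' g) hW (G := 0) (by rw [hg, map_zero]), map_zero,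
      map_zero]
  have hrestr : IsRestriction O h D D' := fun f => by
    rw [← res_self O (D' _)]
    exact hD.res_eq_of_mem_restrictionGraph (hD' _) le_rfl (res_self O _).symm
  exact ⟨D', ⟨hlocal, hrestr⟩, fun E hE => hE.2.unique hO hrestr hE.1 hlocal⟩

end LocalOperators

section Derivations

variable {p : I →+ ZMod 2} {O : GradedRingedSpace I X} {U V : Opens X} {α : GK I}

lemma parityMul_zero_right (p : I →+ ZMod 2) (α : GK I) : parityMul p α 0 = 0 := by
  have hlift : p.comp (AddMonoidHom.mulRight (0 : I)) = (0 : GK I →+ ZMod 2).comp toGK := by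
    ext i
    simp
  rw [parityMul, hlift]
  exact DFunLike.congr_fun
    (Algebra.GrothendieckAddGroup.lift.apply_symm_apply (0 : GK I →+ ZMod 2)) α

lemma map_mul_of_mem_homDer_of_mem_homog_zero {D : Module.End ℝ (O.Sec U)}
    (hD : D ∈ homDer p O U α) {b : O.Sec U} (hb : b ∈ O.homog U 0) (f : O.Sec U) :
    D (b * f) = D b * f + b * D f := by
  rw [hD.2.2 0 b hb f, parityMul_zero_right, sgn, ZMod.val_zero, pow_zero, one_smul]

lemma isLocalOperator_of_mem_homDer (hO : O.HasBumps) {D : Module.End ℝ (O.Sec U)}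
    (hD : D ∈ homDer p O U α) : IsLocalOperator D := by
  intro V h f hf
  refine eq_of_locally_eq fun x hx => ?_
  obtain ⟨b, hb, hbf, W, hW, hxW, hbW⟩ := hO.exists_mul_eq_zero h hx hf
  have hleibniz : 0 = D b * f + b * D f := by
    rw [← map_mul_of_mem_homDer_of_mem_homog_zero hD hb, hbf, map_zero]
  have hfW : O.res (hW.trans h) f = 0 := by rw [← res_res O h hW, hf, map_zero]
  refine ⟨W, hW, hxW, ?_⟩
  calc O.res hW (O.res h (D f)) = O.res (hW.trans h) (D b * f + b * D f) := by
        rw [map_add, map_mul, map_mul, hfW, hbW, mul_zero, zero_add, one_mul, res_res]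
    _ = O.res hW 0 := by rw [← hleibniz, map_zero, map_zero]

lemma IsRestriction.mem_homDer (hO : O.HasBumps) {h : V ≤ U} {D : Module.End ℝ (O.Sec U)}
    {D' : Module.End ℝ (O.Sec V)} (hDD' : IsRestriction O h D D') (hD' : IsLocalOperator D')
    (hD : D ∈ homDer p O U α) : D' ∈ homDer p O V α := by
  refine ⟨fun i j hij f hf => mem_homog_of_locally fun x hx => ?_,
    fun i hi f hf => eq_of_locally_eq fun x hx => ?_,
    fun i f hf g => eq_of_locally_eq fun x hx => ?_⟩
  all_goals obtain ⟨W, hW, F, hxW, hF, hFhomog⟩ := hO.exists_local_extension h hx f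
  · refine ⟨W, hW, hxW, ?_⟩
    rw [hDD'.res_apply_eq hD' hW hF]
    exact res_mem_homog _ (hD.1 i j hij F (hFhomog i hf))
  · refine ⟨W, hW, hxW, ?_⟩
    rw [hDD'.res_apply_eq hD' hW hF, hD.2.1 i hi F (hFhomog i hf), map_zero, map_zero]
  · obtain ⟨W', hW', G, hxW', hG, -⟩ := hO.exists_local_extension h hx g
    have hF' := res_eq_res_of_le hF (inf_le_left : W ⊓ W' ≤ W)
    have hG' := res_eq_res_of_le hG (inf_le_right : W ⊓ W' ≤ W')
    have hFG : O.res ((inf_le_left.trans hW).trans h) (F * G) =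
        O.res (inf_le_left.trans hW : W ⊓ W' ≤ V) (f * g) := by rw [map_mul, map_mul, hF', hG']
    refine ⟨W ⊓ W', inf_le_left.trans hW, ⟨hxW, hxW'⟩, ?_⟩
    rw [hDD'.res_apply_eq hD' _ hFG, hD.2.2 i F (hFhomog i hf) G]
    simp only [map_add, map_mul, map_smul, hDD'.res_apply_eq hD' _ hF',
      hDD'.res_apply_eq hD' _ hG', hF', hG']

theorem existsUnique_restriction_of_mem_homDer (hO : O.HasBumps) (h : V ≤ U)
    {D : Module.End ℝ (O.Sec U)} (hD : D ∈ homDer p O U α) :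
    ∃! D', D' ∈ homDer p O V α ∧ IsRestriction O h D D' := by
  obtain ⟨D', ⟨hD', hDD'⟩, huniq⟩ :=
    (isLocalOperator_of_mem_homDer hO hD).existsUnique_restriction hO h
  exact ⟨D', ⟨hDD'.mem_homDer hO hD' hD, hDD'⟩,
    fun E hE => huniq E ⟨isLocalOperator_of_mem_homDer hO hE.1, hE.2⟩⟩

lemma mem_homDer_of_cover {ι : Type*} {V : ι → Opens X} (hV : ∀ a, V a ≤ U) (hc : U ≤ iSup V)
    {E : Module.End ℝ (O.Sec U)} {D : ∀ a, Module.End ℝ (O.Sec (V a))}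
    (hD : ∀ a, D a ∈ homDer p O (V a) α) (hE : ∀ a, IsRestriction O (hV a) E (D a)) :
    E ∈ homDer p O U α := by
  refine ⟨fun i j hij f hf => mem_homog_of_locally fun x hx => ?_,
    fun i hi f hf => eq_of_cover hV hc fun a => ?_,
    fun i f hf g => eq_of_cover hV hc fun a => ?_⟩
  · obtain ⟨a, ha⟩ := Opens.mem_iSup.1 (hc hx)
    exact ⟨V a, hV a, ha, hE a f ▸ (hD a).1 i j hij _ (res_mem_homog (hV a) hf)⟩
  · rw [← hE a, (hD a).2.1 i hi _ (res_mem_homog (hV a) hf), map_zero]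
  · rw [← hE a, map_mul, (hD a).2.2 i _ (res_mem_homog (hV a) hf)]
    simp only [map_add, map_mul, map_smul, ← hE a _]

end Derivations

section SheafOfVectorFields

variable {p : I →+ ZMod 2} {O : GradedRingedSpace I X}

lemma exists_linearMap_restriction (hO : O.HasBumps) {U V : Opens X} (h : V ≤ U) (α : GK I) :
    ∃ ρ : homDer p O U α →ₗ[ℝ] homDer p O V α, ∀ D, IsRestriction O h D.1 (ρ D).1 := by
  let G : Submodule ℝ (homDer p O U α × homDer p O V α) :=
    { carrier := {q | IsRestriction O h q.1.1 q.2.1}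
      add_mem' := fun {q r} hq hr f => by
        simp only [Prod.snd_add, Prod.fst_add, Submodule.coe_add, LinearMap.add_apply, map_add,
          hq f, hr f]
      zero_mem' := fun _ => (map_zero (O.res h)).symm
      smul_mem' := fun c q hq f => by
        simp only [Prod.smul_snd, Prod.smul_fst, Submodule.coe_smul, LinearMap.smul_apply,
          map_smul, hq f] }
  refine exists_linearMap_of_existsUnique G fun D => ?_
  obtain ⟨D', ⟨hD', hDD'⟩, huniq⟩ := existsUnique_restriction_of_mem_homDer hO h D.2
  exact ⟨⟨D', hD'⟩, hDD', fun E hE => Subtype.ext (huniq E ⟨E.2, hE⟩)⟩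

/-- The presheaf structure on vector fields in the presence of bump functions: the restriction of a
derivation is the unique one of the same degree that is compatible with restrictions of
sections. -/
def restrictions (p : I →+ ZMod 2) (hO : O.HasBumps) : Restrictions p O :=
  have huniq {U V : Opens X} {h : V ≤ U} {α : GK I} {D : homDer p O U α} {D₁ D₂ : homDer p O V α}
      (h₁ : IsRestriction O h D.1 D₁.1) (h₂ : IsRestriction O h D.1 D₂.1) : D₁ = D₂ :=
    Subtype.ext ((existsUnique_restriction_of_mem_homDer hO h D.2).unique ⟨D₁.2, h₁⟩ ⟨D₂.2, h₂⟩)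
  have hres {U V : Opens X} (h : V ≤ U) (α : GK I) (D : homDer p O U α) :
      IsRestriction O h D.1 ((exists_linearMap_restriction hO h α).choose D).1 :=
    (exists_linearMap_restriction hO h α).choose_spec D
  { map := fun h α => (exists_linearMap_restriction hO h α).choose
    isRestriction := hres
    map_id := fun U α => LinearMap.ext fun D => huniq (hres le_rfl α D) fun f => by
      rw [res_self, res_self, LinearMap.id_apply]
    map_comp := fun h h' α => LinearMap.ext fun D =>
      huniq (hres (h'.trans h) α D) ((hres h α D).trans (hres h' α _)) }

namespace Restrictions

variable (R : Restrictions p O)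

theorem existsUnique_glue (hO : O.HasBumps) {α : GK I} {ι : Type*} {U : Opens X} {V : ι → Opens X}
    (hV : ∀ a, V a ≤ U) (hc : U ≤ iSup V) (D : ∀ a, homDer p O (V a) α)
    (hD : ∀ a b, R.map (inf_le_left : V a ⊓ V b ≤ V a) α (D a) =
      R.map (inf_le_right : V a ⊓ V b ≤ V b) α (D b)) :
    ∃! E : homDer p O U α, ∀ a, R.map (hV a) α E = D a := by
  obtain ⟨E, hE⟩ := exists_isRestriction_of_cover hV hc (fun a => (D a).1) fun a b f => by
    rw [← R.isRestriction inf_le_left α (D a), ← R.isRestriction inf_le_right α (D b), hD,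
      res_res, res_res]
  have hEder : E ∈ homDer p O U α := mem_homDer_of_cover hV hc (fun a => (D a).2) hE
  refine ⟨⟨E, hEder⟩, fun a => Subtype.ext ?_, fun E' hE' => Subtype.ext (LinearMap.ext fun f =>
    eq_of_cover hV hc fun a => ?_)⟩
  · exact (existsUnique_restriction_of_mem_homDer hO (hV a) hEder).unique
      ⟨(R.map (hV a) α ⟨E, hEder⟩).2, R.isRestriction (hV a) α _⟩ ⟨(D a).2, hE a⟩
  · rw [← R.isRestriction (hV a) α E', hE', hE]

lemma presheafDeg_isSheaf (hO : O.HasBumps) (α : GK I) : (R.presheafDeg α).IsSheaf := by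
  rw [TopCat.Presheaf.isSheaf_iff_isSheafUniqueGluing]
  intro ι V D hD
  exact R.existsUnique_glue hO (le_iSup V) le_rfl D hD

lemma presheaf_isSheaf (hO : O.HasBumps) : R.presheaf.IsSheaf := by
  rw [TopCat.Presheaf.isSheaf_iff_isSheafUniqueGluing]
  intro ι V D hD
  have hglue (α : GK I) : ∃! E : homDer p O (iSup V) α, ∀ a, R.map (le_iSup V a) α E = D a α :=
    R.existsUnique_glue hO (le_iSup V) le_rfl (fun a => D a α) fun a b => congrFun (hD a b) α
  choose E hE hEuniq using hglue
  exact ⟨E, fun a => funext fun α => hE α a,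
    fun E' hE' => funext fun α => hEuniq α (E' α) fun a => congrFun (hE' a) α⟩

end Restrictions

end SheafOfVectorFields

section BumpFunctions

variable {p : I →+ ZMod 2} {n : ℕ} {m : I →₀ ℕ}

/-- A smooth real function `f` as a function on the graded domain over `W`. -/
def smoothFun (p : I →+ ZMod 2) (m : I →₀ ℕ) (W : Opens (EuclideanSpace ℝ (Fin n)))
    {f : EuclideanSpace ℝ (Fin n) → ℝ} (hf : ContDiff ℝ ∞ f) : domAlg p n m W :=
  ⟨fun x => algebraMap ℝ _ (f x), fun k => by
    simp only [Algebra.algebraMap_eq_smul_one, PowerSeries.coeff_smul, PowerSeries.coeff_one]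
    split_ifs with hk
    · subst hk
      refine ⟨fun x => Submodule.smul_mem _ _ (one_mem_symPow p m), fun _ => ?_⟩
      simp only [map_smul, smul_eq_mul]
      exact (hf.contMDiff.comp contMDiff_subtype_val).mul contMDiff_const
    · simp only [smul_zero, map_zero]
      exact ⟨fun _ => zero_mem _, fun _ => contMDiff_const⟩⟩

lemma domComp_zero_smoothFun (W : Opens (EuclideanSpace ℝ (Fin n)))
    {f : EuclideanSpace ℝ (Fin n) → ℝ} (hf : ContDiff ℝ ∞ f) :
    domComp p n m W 0 (smoothFun p m W hf) = smoothFun p m W hf := by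
  refine domAlg_ext p n m fun x k => ?_
  rw [coeff_domComp]
  simp only [smoothFun, Algebra.algebraMap_eq_smul_one, PowerSeries.coeff_smul,
    PowerSeries.coeff_one]
  split_ifs
  · rw [map_smul, symProj_one]
  · simp

lemma domRes_smoothFun_eq_algebraMap {W W' : Opens (EuclideanSpace ℝ (Fin n))} (h : W' ≤ W)
    {f : EuclideanSpace ℝ (Fin n) → ℝ} (hf : ContDiff ℝ ∞ f) {a : ℝ} (ha : ∀ y ∈ W', f y = a) :
    domRes p n m h (smoothFun p m W hf) = algebraMap ℝ _ a :=
  Subtype.ext (funext fun y => congrArg (algebraMap ℝ (PowerSeries (Sym p m))) (ha y y.2))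

namespace Chart

variable {O : GradedRingedSpace I X} (c : Chart O p n m)

/-- The domain of a chart as an open set of the form for which `Chart.iso` is available. -/
def domain : Opens X := pullOpen c.homeo ⟨c.homeo.target, c.homeo.open_target⟩

lemma mem_domain_iff {x : X} : x ∈ c.domain ↔ x ∈ c.homeo.source :=
  ⟨fun hx => hx.1, fun hx => ⟨hx, c.homeo.map_source hx⟩⟩

variable {f : EuclideanSpace ℝ (Fin n) → ℝ} (hf : ContDiff ℝ ∞ f)

/-- The pullback of a smooth real function along a chart, as a section over the domain of the
chart. -/
def pullback : O.Sec c.domain := (c.iso _ subset_rfl).symm (smoothFun p m _ hf)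

lemma iso_pullback : c.iso _ subset_rfl (c.pullback hf) = smoothFun p m _ hf :=
  AlgEquiv.apply_symm_apply _ _

lemma pullback_mem_homog : c.pullback hf ∈ O.homog c.domain 0 := by
  rw [mem_homog_iff]
  apply (c.iso _ subset_rfl).injective
  refine (c.iso_comp _ _ _ _).trans ?_
  rw [iso_pullback]
  exact domComp_zero_smoothFun _ hf

lemma res_pullback_eq_algebraMap {W : Opens X} (hW : W ≤ c.domain) {a : ℝ}
    (ha : ∀ y ∈ W, f (c.homeo y) = a) : O.res hW (c.pullback hf) = algebraMap ℝ _ a := by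
  let W' : Opens (EuclideanSpace ℝ (Fin n)) :=
    ⟨c.homeo.target ∩ c.homeo.symm ⁻¹' W, c.homeo.isOpen_inter_preimage_symm W.isOpen⟩
  have hW' : W' ≤ ⟨c.homeo.target, c.homeo.open_target⟩ := Set.inter_subset_left
  have hWW' : W ≤ pullOpen c.homeo W' := fun y hy => by
    have hysource := c.mem_domain_iff.1 (hW hy)
    exact ⟨hysource, c.homeo.map_source hysource, by
      rwa [Set.mem_preimage, c.homeo.left_inv hysource]⟩
  have hfW' : ∀ z ∈ W', f z = a := fun z hz => by rw [← ha _ hz.2, c.homeo.right_inv hz.1]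
  have hdomain : pullOpen c.homeo W' ≤ c.domain := pullOpen_mono c.homeo hW'
  have hres : O.res hdomain (c.pullback hf) = algebraMap ℝ _ a := by
    apply (c.iso W' hW').injective
    refine (c.iso_res hW' subset_rfl hW' _).trans ?_
    rw [iso_pullback, domRes_smoothFun_eq_algebraMap hW' hf hfW', AlgEquiv.commutes]
  rw [← res_res O hdomain hWW', hres, AlgHom.commutes]

end Chart

lemma exists_closedBall_subset_preimage_symm {E Y : Type*} [PseudoMetricSpace E]
    [TopologicalSpace Y] (e : OpenPartialHomeomorph Y E) {V : Set Y} (hV : IsOpen V) {x : Y}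
    (hx : x ∈ e.source) (hxV : x ∈ V) :
    ∃ r > 0, Metric.closedBall (e x) r ⊆ e.target ∩ e.symm ⁻¹' V :=
  Metric.nhds_basis_closedBall.mem_iff.1 <| (e.isOpen_inter_preimage_symm hV).mem_nhds
    ⟨e.map_source hx, by rwa [Set.mem_preimage, e.left_inv hx]⟩

lemma isClosed_image_symm_closedBall {E Y : Type*} [PseudoMetricSpace E] [ProperSpace E]
    [TopologicalSpace Y] [T2Space Y] (e : OpenPartialHomeomorph Y E) {z : E} {r : ℝ}
    (h : Metric.closedBall z r ⊆ e.target) : IsClosed (e.symm '' Metric.closedBall z r) :=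
  ((isCompact_closedBall z r).image_of_continuousOn (e.continuousOn_symm.mono h)).isClosed

theorem GradedManifold.hasBumps [T2Space X] (M : GradedManifold p n m X) :
    M.toGradedRingedSpace.HasBumps := by
  intro V x hxV
  obtain ⟨c, hxc⟩ := M.exists_chart x
  let e := c.homeo
  obtain ⟨r, hr, hball⟩ := exists_closedBall_subset_preimage_symm e V.isOpen hxc hxV
  let φ : ContDiffBump (e x) := ⟨r / 2, r, half_pos hr, half_lt_self hr⟩
  let K : Set X := e.symm '' Metric.closedBall (e x) r
  have hKclosed : IsClosed K :=
    isClosed_image_symm_closedBall e (hball.trans Set.inter_subset_left)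
  have hKdomain : K ⊆ c.domain := by
    rintro _ ⟨z, hz, rfl⟩
    exact c.mem_domain_iff.2 (e.map_target (hball hz).1)
  have hKV : K ⊆ V := by
    rintro _ ⟨z, hz, rfl⟩
    exact (hball hz).2
  have hmemK {y : X} (hy : y ∈ e.source) (hyr : dist (e y) (e x) ≤ r) : y ∈ K :=
    ⟨e y, hyr, e.left_inv hy⟩
  let Z : Opens X := ⟨Kᶜ, hKclosed.isOpen_compl⟩
  have hcover {U : Opens X} (hU : K ⊆ U) : ⊤ ≤ U ⊔ Z := fun y _ =>
    (em (y ∈ K)).imp (fun hy => hU hy) id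
  let W : Opens X := pullOpen e ⟨Metric.ball (e x) (r / 2), Metric.isOpen_ball⟩
  have hWK : (W : Set X) ⊆ K := fun y hy =>
    hmemK hy.1 ((Metric.mem_ball.1 hy.2).le.trans (half_le_self hr.le))
  have hWdomain : W ≤ c.domain := hWK.trans hKdomain
  have hφW : M.res hWdomain (c.pullback φ.contDiff) = 1 := by
    rw [c.res_pullback_eq_algebraMap _ hWdomain fun y hy =>
      φ.one_of_mem_closedBall (Metric.ball_subset_closedBall hy.2), map_one]
  have hφZ : M.res (inf_le_left : c.domain ⊓ Z ≤ c.domain) (c.pullback φ.contDiff) = 0 := by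
    have hφ0 : ∀ y ∈ c.domain ⊓ Z, φ (e y) = 0 := fun y hy =>
      φ.zero_of_le_dist (le_of_not_ge fun hyr => hy.2 (hmemK (c.mem_domain_iff.1 hy.1) hyr))
    rw [c.res_pullback_eq_algebraMap _ inf_le_left hφ0, map_zero]
  obtain ⟨b, hb, hbZ, hbhomog⟩ :=
    exists_extension_by_zero le_top le_top (hcover hKdomain) (c.pullback φ.contDiff) hφZ
  refine ⟨b, hbhomog 0 (c.pullback_mem_homog _), W, Z, ⟨hxc, Metric.mem_ball_self (half_pos hr)⟩,
    hWK.trans hKV, top_le_iff.1 (hcover hKV), ?_, hbZ⟩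
  rw [← res_res _ le_top hWdomain, hb, hφW]

end BumpFunctions

end MonGraded

end

theorem mainTheorem6_general {I : Type w} [NonUnitalCommSemiring I] (p : I →+ ZMod 2)
    {X : TopCat.{u}} {O : MonGraded.GradedRingedSpace I X} (hO : O.HasBumps) :
    (∀ (U V : TopologicalSpace.Opens X) (h : V ≤ U) (α : MonGraded.GK I),
      ∀ D ∈ MonGraded.homDer p O U α,
        ∃! D', D' ∈ MonGraded.homDer p O V α ∧ MonGraded.IsRestriction O h D D') ∧
    ∃ R : MonGraded.Restrictions p O,
      (∀ α : MonGraded.GK I, (R.presheafDeg α).IsSheaf) ∧ R.presheaf.IsSheaf :=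
  ⟨fun _ _ h _ _ hD => MonGraded.existsUnique_restriction_of_mem_homDer hO h hD,
    MonGraded.restrictions p hO,
    fun α => (MonGraded.restrictions p hO).presheafDeg_isSheaf hO α,
    (MonGraded.restrictions p hO).presheaf_isSheaf hO⟩

theorem mainTheorem6 {I : Type w} [NonUnitalCommSemiring I] [IsCancelAdd I] [Countable I]
    (p : I →+ ZMod 2) (n : ℕ) (m : I →₀ ℕ)
    (X : TopCat.{u}) [T2Space X] [SecondCountableTopology X]
    (M : MonGraded.GradedManifold p n m X) :
    (∀ (U V : TopologicalSpace.Opens X) (h : V ≤ U) (α : MonGraded.GK I),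
      ∀ D ∈ MonGraded.homDer p M.toGradedRingedSpace U α,
        ∃! D', D' ∈ MonGraded.homDer p M.toGradedRingedSpace V α ∧
          MonGraded.IsRestriction M.toGradedRingedSpace h D D') ∧
    ∃ R : MonGraded.Restrictions p M.toGradedRingedSpace,
      (∀ α : MonGraded.GK I, (R.presheafDeg α).IsSheaf) ∧ R.presheaf.IsSheaf :=
  mainTheorem6_general p M.hasBumps
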